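/- Let $n,m\in\mathbb N$, $A\in\mathbb R^{n\times n}$, $0\neq B\in\mathbb R^{n\times m}$, $\kappa>0$, $K\in\mathbb R$, $b>0$, $z\in\mathbb R^n$, and let $P\in\mathbb R^{n\times n}$ be symmetric positive semidefinite. Let $\phi:[0,b^2)\to\mathbb R$ be twice continuously differentiable (one-sided at $0$) with $\phi''>0$, $\lim_{\rho\uparrow b^2}\phi(\rho)=\infty$ and $\phi'(0)\ge -K$. Let $\Phi(\rho)=\phi(\rho)$ for $\rho\in[0,b^2)$ and $\Phi(\rho)=+\infty$ otherwise. Let $a(\beta)=\beta\,(\phi')^{-1}(\beta)-\phi\big((\phi')^{-1}(\beta)\big)$ for $\beta\ge\phi'(0)$, and let $a^{-1}:[-\phi(0),\infty)\to[\phi'(0),\infty)$ be its inverse. For $t>0$ let $\mathcal U[0,t]=L^2([0,t];\mathbb R^m)$ and let $\mathcal A[0,t]$ be the set of measurable functions $\alpha:[0,t]\to[-\phi(0),\infty)$. For $x\in\mathbb R^n$ and $u\in\mathcal U[0,t]$ let $$\xi_s=e^{As}x+\int_0^s e^{A(s-\sigma)}Bu_\sigma\,d\sigma\quad(s\in[0,t]),\qquad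 \Psi(y)=\tfrac12\langle y-z,P(y-z)\rangle ,$$ and define the regulator cost and the game cost $$\bar J_t(x,u)=\int_0^t \tfrac K2|\xi_s|^2+\tfrac12\Phi(|\xi_s|^2)\,ds+\tfrac\kappa2\|u\|^2_{L^2}+\Psi(\xi_t),$$ $$J_t(x,u,\alpha)=\int_0^t \tfrac K2|\xi_s|^2+\tfrac12\big(a^{-1}(\alpha_s)|\xi_s|^2-\alpha_s\big)\,ds+\tfrac\kappa2\|u\|^2_{L^2}+\Psi(\xi_t),$$ where integrals are taken in $[-\infty,\infty]$ as the integral of the positive part minus that of the negative part, with the convention $\infty-\infty=-\infty$. Then for every $t>0$ and every $x\in\mathbb R^n$, as elements of $[-\infty,\infty]$, the upper value $W_t(x)=\inf_{u\in\mathcal U[0,t]}\sup_{\alpha\in\mathcal A[0,t]}J_t(x,u,\alpha)$ of the game satisfies $$W_t(x)=\inf_{u\in\mathcal U[0,t]}\bar J_t(x,u)\qquad\text{and}\qquad W_t(x)=\sup_{\alpha\in\mathcal A[0,t]}\inf_{u\in\mathcal U[0,t]}J_t(x,u,\alpha).$$ -/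

import Mathlib

open MeasureTheory Set Filter Topology

/-- The a priori fixed data of the state constrained linear regulator problem with state space
`ℝⁿ` and control space `ℝᵐ` (pure data, no assumptions): the dynamics `A`, `B`, the radius `b` of
the constraint ball, the function `φ` on `[0, b²)` (its values elsewhere are irrelevant), the
weights `K`, `κ` of the running costs, and the weight `P` and centre `z` of the terminal cost. -/
structure RegulatorData (n m : ℕ) where
  A : Matrix (Fin n) (Fin n) ℝ
  B : Matrix (Fin n) (Fin m) ℝ
  b : ℝ
  φ : ℝ → ℝ
  K : ℝ
  κ : ℝ
  P : Matrix (Fin n) (Fin n) ℝ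
  z : EuclideanSpace ℝ (Fin n)

/-- The space of open loop controls `L²([0,t]; ℝᵐ)`. -/
abbrev ControlSpace (m : ℕ) (t : ℝ) : Type :=
  Lp (EuclideanSpace ℝ (Fin m)) 2 (volume.restrict (Icc (0 : ℝ) t))

/-- The integral over `[0,t]` of an extended real valued function: the integral of the positive
part minus that of the negative part, with `∞ - ∞ = -∞`. -/
noncomputable def extIntegral (t : ℝ) (f : ℝ → EReal) : EReal :=
  ((∫⁻ s in Icc (0 : ℝ) t, (f s).toENNReal : ENNReal) : EReal)
    - ((∫⁻ s in Icc (0 : ℝ) t, (-f s).toENNReal : ENNReal) : EReal)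

namespace RegulatorData

variable {n m : ℕ} (D : RegulatorData n m)

/-- The state trajectory `ξ_s = e^{As} x + ∫₀ˢ e^{A(s-σ)} B u_σ dσ`. -/
noncomputable def traj {t : ℝ} (x : EuclideanSpace ℝ (Fin n)) (u : ControlSpace m t) (s : ℝ) :
    EuclideanSpace ℝ (Fin n) :=
  Matrix.toEuclideanLin (NormedSpace.exp (s • D.A)) x
    + ∫ σ in (0 : ℝ)..s, Matrix.toEuclideanLin (NormedSpace.exp ((s - σ) • D.A) * D.B) (u σ)

/-- `φ'` on `[0, b²)` (one-sided at `0`). -/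
noncomputable def dφ (ρ : ℝ) : ℝ := derivWithin D.φ (Ico 0 (D.b ^ 2)) ρ

/-- `φ''` on `[0, b²)` (one-sided at `0`). -/
noncomputable def ddφ (ρ : ℝ) : ℝ := derivWithin D.dφ (Ico 0 (D.b ^ 2)) ρ

/-- The barrier function: `φ` on `[0, b²)` and `+∞` elsewhere. -/
noncomputable def barrier (ρ : ℝ) : EReal :=
  open Classical in if ρ ∈ Ico 0 (D.b ^ 2) then (D.φ ρ : EReal) else ⊤

/-- `(φ')⁻¹ : [φ'(0), ∞) → [0, b²)`. -/
noncomputable def dφInv : ℝ → ℝ := Function.invFunOn D.dφ (Ico 0 (D.b ^ 2))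

/-- The convex dual `a(β) = β (φ')⁻¹(β) - φ((φ')⁻¹(β))`, for `β ≥ φ'(0)`. -/
noncomputable def dual (β : ℝ) : ℝ := β * D.dφInv β - D.φ (D.dφInv β)

/-- `a⁻¹ : [-φ(0), ∞) → [φ'(0), ∞)`. -/
noncomputable def dualInv : ℝ → ℝ := Function.invFunOn D.dual (Ici (D.dφ 0))

/-- The control cost `(κ/2) ‖u‖²`. -/
noncomputable def controlCost {t : ℝ} (u : ControlSpace m t) : ℝ := D.κ / 2 * ‖u‖ ^ 2

/-- The terminal cost `Ψ(x) = ½ ⟨x - z, P (x - z)⟩`. -/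
noncomputable def terminalCost (x : EuclideanSpace ℝ (Fin n)) : ℝ :=
  1 / 2 * inner ℝ (x - D.z) (Matrix.toEuclideanLin D.P (x - D.z))

/-- The cost of the state constrained regulator problem:
`∫₀ᵗ (K/2) |ξ_s|² + ½ Φ(|ξ_s|²) ds + (κ/2) ‖u‖² + Ψ(ξ_t)`. -/
noncomputable def regulatorCost (t : ℝ) (x : EuclideanSpace ℝ (Fin n)) (u : ControlSpace m t) :
    EReal :=
  extIntegral t (fun s => ((D.K / 2 * ‖D.traj x u s‖ ^ 2 : ℝ) : EReal)
      + ((1 / 2 : ℝ) : EReal) * D.barrier (‖D.traj x u s‖ ^ 2))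
    + (D.controlCost u : EReal) + (D.terminalCost (D.traj x u t) : EReal)

/-- The value function of the state constrained regulator problem. -/
noncomputable def regulatorValue (t : ℝ) (x : EuclideanSpace ℝ (Fin n)) : EReal :=
  ⨅ u : ControlSpace m t, D.regulatorCost t x u

/-- The policies of the maximizing player: the (Lebesgue) measurable functions from `[0,t]` to
`[-φ(0), ∞)`; values outside `[0,t]` are irrelevant. -/
def advPolicies (t : ℝ) : Set (ℝ → ℝ) :=
  {α | AEMeasurable α (volume.restrict (Icc (0 : ℝ) t)) ∧ ∀ s ∈ Icc (0 : ℝ) t, -D.φ 0 ≤ α s}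

/-- The running cost of the game: `ν(x, α) = (K/2) |x|² + ½ (a⁻¹(α) |x|² - α)`. -/
noncomputable def gameRunningCost (x : EuclideanSpace ℝ (Fin n)) (α : ℝ) : ℝ :=
  D.K / 2 * ‖x‖ ^ 2 + 1 / 2 * (D.dualInv α * ‖x‖ ^ 2 - α)

/-- The cost of the game: `J_t(x,u,α) = ∫₀ᵗ ν(ξ_s, α_s) ds + (κ/2) ‖u‖² + Ψ(ξ_t)`. The integral is
taken in the extended reals, since `α` may be unbounded. -/
noncomputable def gameCost (t : ℝ) (x : EuclideanSpace ℝ (Fin n)) (u : ControlSpace m t)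
    (α : ℝ → ℝ) : EReal :=
  extIntegral t (fun s => (D.gameRunningCost (D.traj x u s) (α s) : EReal))
    + (D.controlCost u : EReal) + (D.terminalCost (D.traj x u t) : EReal)

/-- The upper value `inf_u sup_α J_t(x,u,α)` of the game. -/
noncomputable def upperValue (t : ℝ) (x : EuclideanSpace ℝ (Fin n)) : EReal :=
  ⨅ u : ControlSpace m t, ⨆ α ∈ D.advPolicies t, D.gameCost t x u α

/-- The lower value `sup_α inf_u J_t(x,u,α)` of the game. -/
noncomputable def lowerValue (t : ℝ) (x : EuclideanSpace ℝ (Fin n)) : EReal :=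
  ⨆ α ∈ D.advPolicies t, ⨅ u : ControlSpace m t, D.gameCost t x u α

end RegulatorData

namespace RegulatorData

variable {n m : ℕ} (D : RegulatorData n m)

/-- The standing assumptions on the data of the regulator problem. -/
structure IsAdmissible : Prop where
  κ_pos : 0 < D.κ
  P_posSemidef : D.P.PosSemidef
  b_pos : 0 < D.b
  contDiffOn : ContDiffOn ℝ 2 D.φ (Ico 0 (D.b ^ 2))
  ddφ_pos : ∀ ρ ∈ Ico 0 (D.b ^ 2), 0 < D.ddφ ρ
  tendsto_φ : Tendsto D.φ (𝓝[<] (D.b ^ 2)) atTop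
  neg_K_le : -D.K ≤ D.dφ 0

/-- The value at `ρ` of the tangent line to `φ` at `q`. -/
noncomputable def tangent (q ρ : ℝ) : ℝ := D.φ q + D.dφ q * (ρ - q)

/-- The dual evaluated at the slope `φ'(q)`. -/
noncomputable def dualAtSlope (q : ℝ) : ℝ := q * D.dφ q - D.φ q

namespace IsAdmissible

variable {D}

lemma zero_mem (h : D.IsAdmissible) : (0 : ℝ) ∈ Ico 0 (D.b ^ 2) :=
  ⟨le_rfl, pow_pos h.b_pos 2⟩

lemma continuousOn_dφ (h : D.IsAdmissible) : ContinuousOn D.dφ (Ico 0 (D.b ^ 2)) :=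
  h.contDiffOn.continuousOn_derivWithin (uniqueDiffOn_Ico _ _) (by norm_num)

lemma strictMonoOn_dφ (h : D.IsAdmissible) : StrictMonoOn D.dφ (Ico 0 (D.b ^ 2)) := by
  refine strictMonoOn_of_deriv_pos (convex_Ico _ _) h.continuousOn_dφ fun ρ hρ => ?_
  have := h.ddφ_pos ρ (interior_subset hρ)
  rwa [ddφ, derivWithin_of_mem_nhds (mem_interior_iff_mem_nhds.1 hρ)] at this

lemma hasDerivAt_φ (h : D.IsAdmissible) {ρ : ℝ} (hρ : ρ ∈ Ioo 0 (D.b ^ 2)) :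
    HasDerivAt D.φ (D.dφ ρ) ρ := by
  have hd := (h.contDiffOn.differentiableOn (by norm_num) ρ (Ioo_subset_Ico_self hρ))
  exact hd.hasDerivWithinAt.hasDerivAt (Ico_mem_nhds hρ.1 hρ.2)

lemma tangent_lt (h : D.IsAdmissible) {q ρ : ℝ} (hq : q ∈ Ico 0 (D.b ^ 2))
    (hρ : ρ ∈ Ico 0 (D.b ^ 2)) (hne : q ≠ ρ) : D.tangent q ρ < D.φ ρ := by
  unfold tangent
  rcases lt_or_gt_of_ne hne with hlt | hlt
  · obtain ⟨c, hc, hcs⟩ := exists_hasDerivAt_eq_slope D.φ D.dφ hlt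
      (h.contDiffOn.continuousOn.mono (Icc_subset_Ico_right hρ.2 |>.trans
        (Ico_subset_Ico_left hq.1)))
      fun y hy => h.hasDerivAt_φ ⟨hq.1.trans_lt hy.1, hy.2.trans hρ.2⟩
    have hm := h.strictMonoOn_dφ hq ⟨hq.1.trans hc.1.le, hc.2.trans hρ.2⟩ hc.1
    rw [eq_div_iff (by linarith)] at hcs
    nlinarith
  · obtain ⟨c, hc, hcs⟩ := exists_hasDerivAt_eq_slope D.φ D.dφ hlt
      (h.contDiffOn.continuousOn.mono (Icc_subset_Ico_right hq.2 |>.trans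
        (Ico_subset_Ico_left hρ.1)))
      fun y hy => h.hasDerivAt_φ ⟨hρ.1.trans_lt hy.1, hy.2.trans hq.2⟩
    have hm := h.strictMonoOn_dφ ⟨hρ.1.trans hc.1.le, hc.2.trans hq.2⟩ hq hc.2
    rw [eq_div_iff (by linarith)] at hcs
    nlinarith

lemma tangent_self (D : RegulatorData n m) (q : ℝ) : D.tangent q q = D.φ q := by
  simp [tangent]

lemma tangent_le (h : D.IsAdmissible) {q ρ : ℝ} (hq : q ∈ Ico 0 (D.b ^ 2))
    (hρ : ρ ∈ Ico 0 (D.b ^ 2)) : D.tangent q ρ ≤ D.φ ρ := by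
  rcases eq_or_ne q ρ with rfl | hne
  · exact (tangent_self D q).le
  · exact (h.tangent_lt hq hρ hne).le

lemma tangent_mono (h : D.IsAdmissible) {q q' ρ : ℝ} (hq : q ∈ Ico 0 (D.b ^ 2))
    (hq' : q' ∈ Ico 0 (D.b ^ 2)) (hqq' : q ≤ q') (hρ : q' ≤ ρ) :
    D.tangent q ρ ≤ D.tangent q' ρ := by
  have h1 := h.tangent_le hq hq'
  have h2 := h.strictMonoOn_dφ.monotoneOn hq hq' hqq'
  unfold tangent at *
  nlinarith

lemma Icc_subset (_ : D.IsAdmissible) {r : ℝ} (hr : r ∈ Ico 0 (D.b ^ 2)) :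
    Icc 0 r ⊆ Ico 0 (D.b ^ 2) := fun _ hq => ⟨hq.1, hq.2.trans_lt hr.2⟩

/-- Among the slopes at points of `[0, r]`, the best one is that at `min ρ r`. -/
lemma tangent_le_tangent_min (h : D.IsAdmissible) {q r ρ : ℝ} (hr : r ∈ Ico 0 (D.b ^ 2))
    (hq : q ∈ Icc 0 r) (hρ : 0 ≤ ρ) : D.tangent q ρ ≤ D.tangent (min ρ r) ρ := by
  rcases le_total ρ r with hle | hle
  · rw [min_eq_left hle, tangent_self]
    exact h.tangent_le (h.Icc_subset hr hq) (h.Icc_subset hr ⟨hρ, hle⟩)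
  · rw [min_eq_right hle]
    exact h.tangent_mono (h.Icc_subset hr hq) hr hq.2 hle

lemma K_add_dφ_nonneg (h : D.IsAdmissible) {q : ℝ} (hq : q ∈ Ico 0 (D.b ^ 2)) :
    0 ≤ D.K + D.dφ q := by
  have := h.strictMonoOn_dφ.monotoneOn h.zero_mem hq hq.1
  linarith [h.neg_K_le]

lemma half_φ_zero_le (h : D.IsAdmissible) {r ρ : ℝ} (hr : r ∈ Ico 0 (D.b ^ 2)) (hρ : 0 ≤ ρ) :
    1 / 2 * D.φ 0 ≤ D.K / 2 * ρ + 1 / 2 * D.tangent (min ρ r) ρ := by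
  have h1 := h.tangent_le_tangent_min hr ⟨le_rfl, hr.1⟩ hρ
  have h2 := h.K_add_dφ_nonneg h.zero_mem
  have : D.tangent 0 ρ = D.φ 0 + D.dφ 0 * ρ := by simp [tangent]
  nlinarith

lemma tendsto_dφ (h : D.IsAdmissible) : Tendsto D.dφ (𝓝[<] (D.b ^ 2)) atTop := by
  have hb := pow_pos h.b_pos 2
  refine tendsto_atTop.2 fun M => ?_
  filter_upwards [h.tendsto_φ.eventually_ge_atTop (D.φ 0 + |M| * D.b ^ 2 + 1),
    Ioo_mem_nhdsLT hb] with q hq hq'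
  have ht := h.tangent_le (Ioo_subset_Ico_self hq') h.zero_mem
  unfold tangent at ht
  by_contra! hlt
  have h1 : D.dφ q * q ≤ |M| * D.b ^ 2 := by
    have := le_abs_self M
    have := abs_nonneg M
    calc D.dφ q * q ≤ |M| * q := by gcongr; exacts [hq'.1.le, by linarith]
      _ ≤ |M| * D.b ^ 2 := by gcongr; exact hq'.2.le
  linarith

lemma tendsto_dualAtSlope (h : D.IsAdmissible) :
    Tendsto D.dualAtSlope (𝓝[<] (D.b ^ 2)) atTop := by
  have hb := pow_pos h.b_pos 2
  have hp : D.b ^ 2 / 2 ∈ Ico 0 (D.b ^ 2) := ⟨by linarith, by linarith⟩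
  have h1 : Tendsto (fun q => D.dφ q * (D.b ^ 2 / 2) + -D.φ (D.b ^ 2 / 2)) (𝓝[<] (D.b ^ 2))
      atTop := tendsto_atTop_add_const_right _ _ (h.tendsto_dφ.atTop_mul_const (by linarith))
  refine tendsto_atTop_mono' _ ?_ h1
  filter_upwards [Ioo_mem_nhdsLT hb] with q hq
  have ht := h.tangent_le (Ioo_subset_Ico_self hq) hp
  unfold tangent at ht
  unfold dualAtSlope
  linarith

lemma continuousOn_dualAtSlope (h : D.IsAdmissible) :
    ContinuousOn D.dualAtSlope (Ico 0 (D.b ^ 2)) :=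
  (continuousOn_id.mul h.continuousOn_dφ).sub h.contDiffOn.continuousOn

lemma dualAtSlope_zero (D : RegulatorData n m) : D.dualAtSlope 0 = -D.φ 0 := by
  simp [dualAtSlope]

lemma strictMonoOn_dualAtSlope (h : D.IsAdmissible) :
    StrictMonoOn D.dualAtSlope (Ico 0 (D.b ^ 2)) := by
  intro q hq q' hq' hlt
  have h1 := h.tangent_lt hq' hq hlt.ne'
  have h2 := h.strictMonoOn_dφ hq hq' hlt
  have h3 := hq.1
  unfold tangent at h1
  unfold dualAtSlope
  nlinarith

/-- A continuous function on `[0, b²)` that tends to infinity takes all values above its value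
at `0`. -/
lemma Ici_subset_image (h : D.IsAdmissible) {f : ℝ → ℝ} (hf : ContinuousOn f (Ico 0 (D.b ^ 2)))
    (hlim : Tendsto f (𝓝[<] (D.b ^ 2)) atTop) : Ici (f 0) ⊆ f '' Ico 0 (D.b ^ 2) := by
  intro y hy
  obtain ⟨q, hq, hq'⟩ := ((hlim.eventually_ge_atTop y).and
    (Ioo_mem_nhdsLT (pow_pos h.b_pos 2))).exists
  have hsub : Icc 0 q ⊆ Ico 0 (D.b ^ 2) := h.Icc_subset (Ioo_subset_Ico_self hq')
  obtain ⟨c, hc, hcy⟩ := intermediate_value_Icc hq'.1.le (hf.mono hsub) ⟨hy, hq⟩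
  exact ⟨c, hsub hc, hcy⟩

lemma dφInv_dφ (h : D.IsAdmissible) {q : ℝ} (hq : q ∈ Ico 0 (D.b ^ 2)) :
    D.dφInv (D.dφ q) = q :=
  h.strictMonoOn_dφ.injOn.leftInvOn_invFunOn hq

lemma dual_dφ (h : D.IsAdmissible) {q : ℝ} (hq : q ∈ Ico 0 (D.b ^ 2)) :
    D.dual (D.dφ q) = D.dualAtSlope q := by
  rw [dual, h.dφInv_dφ hq, dualAtSlope, mul_comm]

lemma injOn_dual (h : D.IsAdmissible) : InjOn D.dual (Ici (D.dφ 0)) := by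
  intro β hβ β' hβ' heq
  obtain ⟨q, hq, rfl⟩ := h.Ici_subset_image h.continuousOn_dφ h.tendsto_dφ hβ
  obtain ⟨q', hq', rfl⟩ := h.Ici_subset_image h.continuousOn_dφ h.tendsto_dφ hβ'
  rw [h.dual_dφ hq, h.dual_dφ hq'] at heq
  rw [h.strictMonoOn_dualAtSlope.injOn hq hq' heq]

lemma dualInv_dualAtSlope (h : D.IsAdmissible) {q : ℝ} (hq : q ∈ Ico 0 (D.b ^ 2)) :
    D.dualInv (D.dualAtSlope q) = D.dφ q := by
  rw [← h.dual_dφ hq]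
  exact h.injOn_dual.leftInvOn_invFunOn (h.strictMonoOn_dφ.monotoneOn h.zero_mem hq hq.1)

lemma neg_φ_zero_le_dualAtSlope (h : D.IsAdmissible) {q : ℝ} (hq : q ∈ Ico 0 (D.b ^ 2)) :
    -D.φ 0 ≤ D.dualAtSlope q := by
  rw [← dualAtSlope_zero]
  exact h.strictMonoOn_dualAtSlope.monotoneOn h.zero_mem hq hq.1

lemma exists_dualAtSlope_eq (h : D.IsAdmissible) {α : ℝ} (hα : -D.φ 0 ≤ α) :
    ∃ q ∈ Ico 0 (D.b ^ 2), D.dualAtSlope q = α := by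
  rw [← dualAtSlope_zero] at hα
  exact h.Ici_subset_image h.continuousOn_dualAtSlope h.tendsto_dualAtSlope hα

lemma gameRunningCost_dualAtSlope (h : D.IsAdmissible) {q : ℝ} (hq : q ∈ Ico 0 (D.b ^ 2))
    (y : EuclideanSpace ℝ (Fin n)) :
    D.gameRunningCost y (D.dualAtSlope q)
      = D.K / 2 * ‖y‖ ^ 2 + 1 / 2 * D.tangent q (‖y‖ ^ 2) := by
  rw [gameRunningCost, h.dualInv_dualAtSlope hq, dualAtSlope, tangent]
  ring

lemma half_mul_barrier_of_mem {ρ : ℝ} (hρ : ρ ∈ Ico 0 (D.b ^ 2)) :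
    ((1 / 2 : ℝ) : EReal) * D.barrier ρ = ((1 / 2 * D.φ ρ : ℝ) : EReal) := by
  rw [barrier, if_pos hρ, EReal.coe_mul]

lemma half_mul_barrier_of_notMem {ρ : ℝ} (hρ : ρ ∉ Ico 0 (D.b ^ 2)) :
    ((1 / 2 : ℝ) : EReal) * D.barrier ρ = ⊤ := by
  rw [barrier, if_neg hρ]
  exact EReal.coe_mul_top_of_pos (by norm_num)

lemma gameRunningCost_le (h : D.IsAdmissible) {α : ℝ} (hα : -D.φ 0 ≤ α)
    (y : EuclideanSpace ℝ (Fin n)) :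
    (D.gameRunningCost y α : EReal)
      ≤ ((D.K / 2 * ‖y‖ ^ 2 : ℝ) : EReal) + ((1 / 2 : ℝ) : EReal) * D.barrier (‖y‖ ^ 2) := by
  obtain ⟨q, hq, rfl⟩ := h.exists_dualAtSlope_eq hα
  by_cases hy : ‖y‖ ^ 2 ∈ Ico 0 (D.b ^ 2)
  · rw [half_mul_barrier_of_mem hy, ← EReal.coe_add, EReal.coe_le_coe_iff,
      h.gameRunningCost_dualAtSlope hq]
    linarith [h.tangent_le hq hy]
  · rw [half_mul_barrier_of_notMem hy, EReal.coe_add_top]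
    exact le_top

/-- The running costs with slopes truncated at `r` converge to the barrier running cost as
`r ↑ b²`. -/
lemma tendsto_truncated (h : D.IsAdmissible) {r : ℕ → ℝ} (hr : ∀ k, r k ∈ Ico 0 (D.b ^ 2))
    (hlim : Tendsto r atTop (𝓝 (D.b ^ 2))) {ρ : ℝ} (hρ : 0 ≤ ρ) :
    Tendsto (fun k => ((D.K / 2 * ρ + 1 / 2 * D.tangent (min ρ (r k)) ρ : ℝ) : EReal)) atTop
      (𝓝 (((D.K / 2 * ρ : ℝ) : EReal) + ((1 / 2 : ℝ) : EReal) * D.barrier ρ)) := by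
  by_cases hb : ρ < D.b ^ 2
  · refine tendsto_const_nhds.congr' ?_
    filter_upwards [hlim.eventually (lt_mem_nhds hb)] with k hk
    rw [half_mul_barrier_of_mem ⟨hρ, hb⟩, ← EReal.coe_add, min_eq_left hk.le, tangent_self]
  · rw [half_mul_barrier_of_notMem fun h' => hb h'.2, EReal.coe_add_top]
    rw [EReal.tendsto_coe_nhds_top_iff]
    have hφ : Tendsto (fun k => D.φ (r k)) atTop atTop :=
      h.tendsto_φ.comp (tendsto_nhdsWithin_iff.2 ⟨hlim, Eventually.of_forall fun k => (hr k).2⟩)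
    have h1 : Tendsto (fun k => 1 / 2 * D.φ (r k) + (D.K / 2 * ρ - 1 / 2 * (|D.dφ 0| * ρ)))
        atTop atTop :=
      tendsto_atTop_add_const_right _ _ (hφ.const_mul_atTop (by norm_num))
    refine tendsto_atTop_mono (fun k => ?_) h1
    have hk : r k ≤ ρ := (hr k).2.le.trans (not_lt.1 hb)
    have h2 := h.strictMonoOn_dφ.monotoneOn h.zero_mem (hr k) (hr k).1
    have h3 : -(|D.dφ 0| * ρ) ≤ D.dφ (r k) * (ρ - r k) := by
      have := neg_abs_le (D.dφ 0)
      have := abs_nonneg (D.dφ 0)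
      have := (hr k).1
      nlinarith
    rw [min_eq_right hk, tangent]
    linarith

lemma truncated_mono (h : D.IsAdmissible) {r r' ρ : ℝ} (hr : r ∈ Ico 0 (D.b ^ 2))
    (hr' : r' ∈ Ico 0 (D.b ^ 2)) (hle : r ≤ r') (hρ : 0 ≤ ρ) :
    D.tangent (min ρ r) ρ ≤ D.tangent (min ρ r') ρ :=
  h.tangent_mono ⟨le_min hρ hr.1, (min_le_right _ _).trans_lt hr.2⟩
    ⟨le_min hρ hr'.1, (min_le_right _ _).trans_lt hr'.2⟩ (min_le_min_left _ hle) (min_le_left _ _)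

end IsAdmissible

end RegulatorData

namespace RegulatorData

variable {n m : ℕ} (D : RegulatorData n m)

/-- The continuous linear map defined by a matrix, as a linear function of the matrix. -/
noncomputable def matrixCLM (k l : ℕ) : Matrix (Fin k) (Fin l) ℝ →ₗ[ℝ]
    (EuclideanSpace ℝ (Fin l) →L[ℝ] EuclideanSpace ℝ (Fin k)) :=
  (LinearMap.toContinuousLinearMap (𝕜 := ℝ) (E := EuclideanSpace ℝ (Fin l))
    (F' := EuclideanSpace ℝ (Fin k))).toLinearMap ∘ₗ Matrix.toEuclideanLin.toLinearMap

lemma matrixCLM_apply {k l : ℕ} (M : Matrix (Fin k) (Fin l) ℝ) (v : EuclideanSpace ℝ (Fin l)) :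
    matrixCLM k l M v = Matrix.toEuclideanLin M v := rfl

lemma continuous_matrixCLM (k l : ℕ) : Continuous (matrixCLM k l) :=
  LinearMap.continuous_of_finiteDimensional _

lemma toEuclideanLin_mul_apply {j k l : ℕ} (M : Matrix (Fin j) (Fin k) ℝ)
    (N : Matrix (Fin k) (Fin l) ℝ) (v : EuclideanSpace ℝ (Fin l)) :
    Matrix.toEuclideanLin (M * N) v = Matrix.toEuclideanLin M (Matrix.toEuclideanLin N v) := by
  simp [Matrix.toLpLin_apply, Matrix.mulVec_mulVec]

lemma continuous_exp_smul (c : ℝ) :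
    Continuous fun s : ℝ => NormedSpace.exp ((c * s) • D.A) := by
  open scoped Matrix.Norms.Operator in
  exact NormedSpace.exp_continuous.comp ((continuous_const.mul continuous_id).smul continuous_const)

/-- The state transition map `e^{As}`. -/
noncomputable def flow (s : ℝ) : EuclideanSpace ℝ (Fin n) →L[ℝ] EuclideanSpace ℝ (Fin n) :=
  matrixCLM n n (NormedSpace.exp (s • D.A))

/-- The input map `e^{-Aσ} B`. -/
noncomputable def inputMap (σ : ℝ) : EuclideanSpace ℝ (Fin m) →L[ℝ] EuclideanSpace ℝ (Fin n) :=
  matrixCLM n m (NormedSpace.exp (-σ • D.A) * D.B)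

lemma continuous_flow : Continuous D.flow := by
  have := (continuous_matrixCLM n n).comp (D.continuous_exp_smul 1)
  simp only [one_mul] at this
  exact this

lemma continuous_inputMap : Continuous D.inputMap := by
  have := (continuous_matrixCLM n m).comp
    ((D.continuous_exp_smul (-1)).matrix_mul (continuous_const (y := D.B)))
  simp only [neg_one_mul] at this
  exact this

lemma flow_inputMap (s σ : ℝ) (v : EuclideanSpace ℝ (Fin m)) :
    D.flow s (D.inputMap σ v)
      = Matrix.toEuclideanLin (NormedSpace.exp ((s - σ) • D.A) * D.B) v := by
  rw [flow, inputMap, matrixCLM_apply, matrixCLM_apply, ← toEuclideanLin_mul_apply,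
    ← Matrix.mul_assoc, ← Matrix.exp_add_of_commute, ← add_smul, sub_eq_add_neg]
  exact ((Commute.refl D.A).smul_left _).smul_right _

variable {t : ℝ}

lemma integrable_control (u : ControlSpace m t) :
    Integrable (fun σ => u σ) (volume.restrict (Icc (0 : ℝ) t)) :=
  (Lp.memLp u).integrable (by norm_num)

lemma exists_integral_norm_le (m : ℕ) (t : ℝ) : ∃ C : ℝ, 0 ≤ C ∧ ∀ u : ControlSpace m t,
    ∫ σ in Icc (0 : ℝ) t, ‖u σ‖ ≤ C * ‖u‖ := by
  set μ := volume.restrict (Icc (0 : ℝ) t) with hμ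
  refine ⟨(μ univ ^ (1 / (1 : ENNReal).toReal - 1 / (2 : ENNReal).toReal)).toReal,
    ENNReal.toReal_nonneg, fun u => ?_⟩
  have hm := Lp.memLp u
  rw [integral_norm_eq_lintegral_enorm hm.1, ← eLpNorm_one_eq_lintegral_enorm, Lp.norm_def,
    mul_comm, ← ENNReal.toReal_mul]
  refine ENNReal.toReal_mono (ENNReal.mul_ne_top hm.2.ne ?_)
    (eLpNorm_le_eLpNorm_mul_rpow_measure_univ (by norm_num) hm.1)
  exact ENNReal.rpow_ne_top_of_nonneg (by norm_num) (measure_ne_top _ _)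

lemma exists_inputMap_bound (t : ℝ) : ∃ C : ℝ, 0 ≤ C ∧ ∀ σ ∈ Icc (0 : ℝ) t,
    ∀ v, ‖D.inputMap σ v‖ ≤ C * ‖v‖ := by
  obtain ⟨C, hC⟩ := (isCompact_Icc (a := (0 : ℝ)) (b := t)).exists_bound_of_continuousOn
    D.continuous_inputMap.continuousOn
  exact ⟨|C|, abs_nonneg C, fun σ hσ v => (D.inputMap σ).le_of_opNorm_le
    ((hC σ hσ).trans (le_abs_self C)) v⟩

lemma integrableOn_input (u : ControlSpace m t) :
    IntegrableOn (fun σ => D.inputMap σ (u σ)) (Icc 0 t) := by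
  obtain ⟨C, -, hC⟩ := D.exists_inputMap_bound t
  refine Integrable.mono' ((integrable_control u).norm.const_mul C) ?_ ?_
  · exact (isBoundedBilinearMap_apply.continuous (𝕜 := ℝ)).comp_aestronglyMeasurable
      (D.continuous_inputMap.aestronglyMeasurable.prodMk (Lp.aestronglyMeasurable u))
  · filter_upwards [ae_restrict_mem measurableSet_Icc] with σ hσ
    exact hC σ hσ _

lemma intervalIntegrable_input (u : ControlSpace m t) {s : ℝ} (hs : s ∈ Icc 0 t) :
    IntervalIntegrable (fun σ => D.inputMap σ (u σ)) volume 0 s :=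
  (intervalIntegrable_iff_integrableOn_Icc_of_le hs.1).2
    ((D.integrableOn_input u).mono_set (Icc_subset_Icc_right hs.2))

lemma traj_eq (x : EuclideanSpace ℝ (Fin n)) (u : ControlSpace m t) {s : ℝ} (hs : s ∈ Icc 0 t) :
    D.traj x u s = D.flow s (x + ∫ σ in (0 : ℝ)..s, D.inputMap σ (u σ)) := by
  rw [map_add, ← ContinuousLinearMap.intervalIntegral_comp_comm _
    (D.intervalIntegrable_input u hs)]
  simp_rw [flow_inputMap]
  rfl

lemma continuousOn_traj (ht : 0 ≤ t) (x : EuclideanSpace ℝ (Fin n)) (u : ControlSpace m t) :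
    ContinuousOn (D.traj x u) (Icc 0 t) := by
  refine ContinuousOn.congr ?_ fun s hs => D.traj_eq x u hs
  refine D.continuous_flow.continuousOn.clm_apply (continuousOn_const.add ?_)
  have hint : IntegrableOn (fun σ => D.inputMap σ (u σ)) (uIcc 0 t) := by
    rw [uIcc_of_le ht]
    exact D.integrableOn_input u
  have := intervalIntegral.continuousOn_primitive_interval hint
  rwa [uIcc_of_le ht] at this

lemma ae_restrict_of_mem {p : ℝ → Prop} {s : ℝ} (hs : s ∈ Icc 0 t)
    (h : ∀ᵐ σ ∂volume.restrict (Icc (0 : ℝ) t), p σ) : ∀ᵐ σ, σ ∈ uIoc 0 s → p σ := by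
  filter_upwards [(ae_restrict_iff' measurableSet_Icc).1 h] with σ h hσ
  rw [uIoc_of_le hs.1] at hσ
  exact h ⟨hσ.1.le, hσ.2.trans hs.2⟩

lemma traj_combination (x : EuclideanSpace ℝ (Fin n)) (u v : ControlSpace m t) (l : ℝ) {s : ℝ}
    (hs : s ∈ Icc 0 t) :
    D.traj x ((1 - l) • u + l • v) s = (1 - l) • D.traj x u s + l • D.traj x v s := by
  have hint : ∫ σ in (0 : ℝ)..s, D.inputMap σ (((1 - l) • u + l • v : ControlSpace m t) σ)
      = (1 - l) • (∫ σ in (0 : ℝ)..s, D.inputMap σ (u σ))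
        + l • ∫ σ in (0 : ℝ)..s, D.inputMap σ (v σ) := by
    have hadd := intervalIntegral.integral_add ((D.intervalIntegrable_input u hs).smul (1 - l))
      ((D.intervalIntegrable_input v hs).smul l)
    simp only [Pi.smul_apply] at hadd
    rw [← intervalIntegral.integral_smul, ← intervalIntegral.integral_smul, ← hadd]
    refine intervalIntegral.integral_congr_ae (ae_restrict_of_mem hs ?_)
    filter_upwards [Lp.coeFn_add ((1 - l) • u) (l • v), Lp.coeFn_smul (1 - l) u,
      Lp.coeFn_smul l v] with σ h1 h2 h3
    rw [h1, Pi.add_apply, h2, h3]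
    simp
  rw [D.traj_eq x _ hs, D.traj_eq x _ hs, D.traj_eq x _ hs, hint, ← map_smul, ← map_smul,
    ← map_add]
  congr 1
  module

lemma exists_traj_sub_bound (t : ℝ) : ∃ C : ℝ, 0 ≤ C ∧
    ∀ (x : EuclideanSpace ℝ (Fin n)) (u v : ControlSpace m t), ∀ s ∈ Icc (0 : ℝ) t,
      ‖D.traj x u s - D.traj x v s‖ ≤ C * ‖u - v‖ := by
  obtain ⟨C₁, hC₁⟩ := (isCompact_Icc (a := (0 : ℝ)) (b := t)).exists_bound_of_continuousOn
    D.continuous_flow.continuousOn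
  obtain ⟨C₂, hC₂0, hC₂⟩ := D.exists_inputMap_bound t
  obtain ⟨C₃, hC₃0, hC₃⟩ := exists_integral_norm_le m t
  refine ⟨|C₁| * (C₂ * C₃), by positivity, fun x u v s hs => ?_⟩
  have hint : (∫ σ in (0 : ℝ)..s, D.inputMap σ (u σ)) - ∫ σ in (0 : ℝ)..s, D.inputMap σ (v σ)
      = ∫ σ in (0 : ℝ)..s, D.inputMap σ ((u - v : ControlSpace m t) σ) := by
    rw [← intervalIntegral.integral_sub (D.intervalIntegrable_input u hs)
      (D.intervalIntegrable_input v hs)]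
    refine intervalIntegral.integral_congr_ae (ae_restrict_of_mem hs ?_)
    filter_upwards [Lp.coeFn_sub u v] with σ h1
    rw [h1, Pi.sub_apply, map_sub]
  rw [D.traj_eq x _ hs, D.traj_eq x _ hs, ← map_sub, add_sub_add_left_eq_sub, hint]
  refine ((D.flow s).le_of_opNorm_le ((hC₁ s hs).trans (le_abs_self C₁)) _).trans ?_
  rw [mul_assoc]
  refine mul_le_mul_of_nonneg_left ?_ (abs_nonneg _)
  set w := u - v
  rw [intervalIntegral.integral_of_le hs.1, ← integral_Icc_eq_integral_Ioc]
  have hsub : Icc 0 s ⊆ Icc 0 t := Icc_subset_Icc_right hs.2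
  have hw : IntegrableOn (fun σ => C₂ * ‖w σ‖) (Icc 0 t) :=
    (integrable_control w).norm.const_mul C₂
  calc ‖∫ σ in Icc 0 s, D.inputMap σ (w σ)‖ ≤ ∫ σ in Icc 0 s, C₂ * ‖w σ‖ := by
        refine norm_integral_le_of_norm_le (hw.mono_set hsub) ?_
        filter_upwards [ae_restrict_mem measurableSet_Icc] with σ hσ
        exact hC₂ σ (hsub hσ) _
    _ ≤ ∫ σ in Icc 0 t, C₂ * ‖w σ‖ :=
        setIntegral_mono_set hw (Eventually.of_forall fun σ => by positivity)
          (Eventually.of_forall hsub)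
    _ = C₂ * ∫ σ in Icc 0 t, ‖w σ‖ := integral_const_mul _ _
    _ ≤ C₂ * C₃ * ‖w‖ := by
        rw [mul_assoc]
        exact mul_le_mul_of_nonneg_left (hC₃ w) hC₂0

lemma tendsto_traj (x : EuclideanSpace ℝ (Fin n)) {u : ℕ → ControlSpace m t}
    {v : ControlSpace m t} (hu : Tendsto u atTop (𝓝 v)) {s : ℝ} (hs : s ∈ Icc 0 t) :
    Tendsto (fun k => D.traj x (u k) s) atTop (𝓝 (D.traj x v s)) := by
  obtain ⟨C, -, hC⟩ := D.exists_traj_sub_bound t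
  rw [tendsto_iff_norm_sub_tendsto_zero] at hu ⊢
  refine squeeze_zero (fun k => norm_nonneg _) (fun k => hC x (u k) v s hs) ?_
  simpa using hu.const_mul C

lemma exists_traj_bound (ht : 0 ≤ t) (x : EuclideanSpace ℝ (Fin n)) {u : ℕ → ControlSpace m t}
    {v : ControlSpace m t} (hu : Tendsto u atTop (𝓝 v)) :
    ∃ R : ℝ, ∀ k, ∀ s ∈ Icc (0 : ℝ) t, ‖D.traj x (u k) s‖ ≤ R := by
  obtain ⟨C, hC0, hC⟩ := D.exists_traj_sub_bound t
  obtain ⟨C', hC'⟩ := isCompact_Icc.exists_bound_of_continuousOn (D.continuousOn_traj ht x v)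
  obtain ⟨C'', hC''⟩ := (tendsto_iff_norm_sub_tendsto_zero.1 hu).bddAbove_range
  refine ⟨C * C'' + C', fun k s hs => ?_⟩
  calc ‖D.traj x (u k) s‖ = ‖(D.traj x (u k) s - D.traj x v s) + D.traj x v s‖ := by
        rw [sub_add_cancel]
    _ ≤ C * C'' + C' := (norm_add_le _ _).trans (add_le_add ((hC x (u k) v s hs).trans
        (mul_le_mul_of_nonneg_left (hC'' ⟨k, rfl⟩) hC0)) (hC' s hs))

end RegulatorData

lemma extIntegral_mono {t : ℝ} {f g : ℝ → EReal} (h : ∀ s ∈ Icc (0 : ℝ) t, f s ≤ g s) :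
    extIntegral t f ≤ extIntegral t g := by
  unfold extIntegral
  refine EReal.sub_le_sub ?_ ?_ <;> refine EReal.coe_ennreal_le_coe_ennreal_iff.2 ?_ <;>
    refine setLIntegral_mono' measurableSet_Icc fun s hs => EReal.toENNReal_le_toENNReal ?_
  · exact h s hs
  · exact EReal.neg_le_neg_iff.2 (h s hs)

lemma extIntegral_congr {t : ℝ} {f g : ℝ → EReal} (h : ∀ s ∈ Icc (0 : ℝ) t, f s = g s) :
    extIntegral t f = extIntegral t g :=
  le_antisymm (extIntegral_mono fun s hs => (h s hs).le)
    (extIntegral_mono fun s hs => (h s hs).ge)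

lemma lintegral_ofReal_ne_top {t : ℝ} {f : ℝ → ℝ} (hf : IntegrableOn f (Icc 0 t)) :
    ∫⁻ s in Icc (0 : ℝ) t, ENNReal.ofReal (f s) ≠ ⊤ :=
  ((lintegral_mono fun _ => Real.ofReal_le_enorm _).trans_lt hf.2).ne

lemma extIntegral_coe {t : ℝ} {f : ℝ → ℝ} (hf : IntegrableOn f (Icc 0 t)) :
    extIntegral t (fun s => (f s : EReal)) = ((∫ s in Icc 0 t, f s : ℝ) : EReal) := by
  rw [integral_eq_lintegral_pos_part_sub_lintegral_neg_part hf, EReal.coe_sub,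
    EReal.coe_ennreal_toReal (lintegral_ofReal_ne_top hf),
    EReal.coe_ennreal_toReal (lintegral_ofReal_ne_top (f := fun s => -f s) hf.neg)]
  rfl

/-- Monotone convergence for the extended integral. -/
lemma tendsto_extIntegral {t : ℝ} {f : ℕ → ℝ → ℝ} {F : ℝ → EReal}
    (hf : ∀ k, IntegrableOn (f k) (Icc 0 t))
    (hmono : ∀ s ∈ Icc (0 : ℝ) t, Monotone fun k => f k s)
    (hlim : ∀ s ∈ Icc (0 : ℝ) t, Tendsto (fun k => (f k s : EReal)) atTop (𝓝 (F s))) :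
    Tendsto (fun k => ((∫ s in Icc 0 t, f k s : ℝ) : EReal)) atTop (𝓝 (extIntegral t F)) := by
  have hpos : Tendsto (fun k => ∫⁻ s in Icc 0 t, ENNReal.ofReal (f k s)) atTop
      (𝓝 (∫⁻ s in Icc 0 t, (F s).toENNReal)) := by
    refine lintegral_tendsto_of_tendsto_of_monotone (fun k => (hf k).aemeasurable.ennreal_ofReal)
      ?_ ?_ <;> filter_upwards [ae_restrict_mem measurableSet_Icc] with s hs
    · exact fun i j hij => ENNReal.ofReal_le_ofReal (hmono s hs hij)
    · exact (EReal.continuous_toENNReal.tendsto _).comp (hlim s hs)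
  have hneg : Tendsto (fun k => ∫⁻ s in Icc 0 t, ENNReal.ofReal (-f k s)) atTop
      (𝓝 (∫⁻ s in Icc 0 t, (-F s).toENNReal)) := by
    refine lintegral_tendsto_of_tendsto_of_antitone
      (fun k => (hf k).neg.aemeasurable.ennreal_ofReal) ?_ (lintegral_ofReal_ne_top (hf 0).neg) ?_
      <;> filter_upwards [ae_restrict_mem measurableSet_Icc] with s hs
    · exact fun i j hij => ENNReal.ofReal_le_ofReal (neg_le_neg (hmono s hs hij))
    · exact (EReal.continuous_toENNReal.tendsto _).comp
        ((continuous_neg.tendsto (F s)).comp (hlim s hs))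
  have hfin : ∫⁻ s in Icc 0 t, (-F s).toENNReal ≠ ⊤ := by
    refine ne_top_of_le_ne_top (lintegral_ofReal_ne_top (hf 0).neg)
      (setLIntegral_mono' measurableSet_Icc fun s hs => ?_)
    refine EReal.toENNReal_le_toENNReal (y := ((-f 0 s : ℝ) : EReal)) ?_
    rw [EReal.coe_neg, EReal.neg_le_neg_iff]
    exact Monotone.ge_of_tendsto
      (fun i j hij => EReal.coe_le_coe_iff.2 (hmono s hs hij)) (hlim s hs) 0
  have hpos' := (continuous_coe_ennreal_ereal.tendsto _).comp hpos
  have hneg' := (continuous_neg.tendsto _).comp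
    ((continuous_coe_ennreal_ereal.tendsto _).comp hneg)
  have hadd := (EReal.continuousAt_add
    (p := (((∫⁻ s in Icc 0 t, (F s).toENNReal : ENNReal) : EReal),
      -((∫⁻ s in Icc 0 t, (-F s).toENNReal : ENNReal) : EReal)))
    (Or.inr (by simpa [EReal.neg_eq_bot_iff] using hfin))
    (Or.inl (EReal.coe_ennreal_ne_bot _))).tendsto.comp (hpos'.prodMk_nhds hneg')
  refine hadd.congr fun k => ?_
  rw [← extIntegral_coe (hf k)]
  rfl

lemma EReal.tendsto_add_coe {f : ℕ → EReal} {y : EReal} (hf : Tendsto f atTop (𝓝 y)) (c : ℝ) :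
    Tendsto (fun k => f k + c) atTop (𝓝 (y + c)) :=
  (EReal.continuousAt_add (p := (y, (c : EReal))) (Or.inr (EReal.coe_ne_bot c))
    (Or.inr (EReal.coe_ne_top c))).tendsto.comp (hf.prodMk_nhds tendsto_const_nhds)

lemma norm_sq_combination {E : Type*} [NormedAddCommGroup E] [InnerProductSpace ℝ E] (a b : E)
    (l : ℝ) : ‖(1 - l) • a + l • b‖ ^ 2
      = (1 - l) * ‖a‖ ^ 2 + l * ‖b‖ ^ 2 - l * (1 - l) * ‖a - b‖ ^ 2 := by
  rw [norm_add_sq_real, norm_sub_sq_real, real_inner_smul_left, real_inner_smul_right,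
    norm_smul, norm_smul, mul_pow, mul_pow, Real.norm_eq_abs, Real.norm_eq_abs, sq_abs, sq_abs]
  ring

namespace RegulatorData

variable {n m : ℕ} (D : RegulatorData n m) {t : ℝ}

/-- The running cost of the game when the maximizing player uses the slopes `φ'(q s)`. -/
noncomputable def slopeRunningCost (x : EuclideanSpace ℝ (Fin n)) (u : ControlSpace m t)
    (q : ℝ → ℝ) (s : ℝ) : ℝ :=
  D.K / 2 * ‖D.traj x u s‖ ^ 2 + 1 / 2 * D.tangent (q s) (‖D.traj x u s‖ ^ 2)

/-- The cost of the game when the maximizing player uses the slopes `φ'(q s)`. -/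
noncomputable def slopeCost (x : EuclideanSpace ℝ (Fin n)) (u : ControlSpace m t)
    (q : ℝ → ℝ) : ℝ :=
  (∫ s in Icc 0 t, D.slopeRunningCost x u q s) + D.controlCost u + D.terminalCost (D.traj x u t)

/-- The squared norm of the state, truncated at `r`. -/
noncomputable def clip (x : EuclideanSpace ℝ (Fin n)) (r : ℝ) (u : ControlSpace m t) (s : ℝ) : ℝ :=
  min (‖D.traj x u s‖ ^ 2) r

/-- The regulator cost with slopes of the barrier truncated at `φ'(r)`. -/
noncomputable def truncCost (x : EuclideanSpace ℝ (Fin n)) (r : ℝ) (u : ControlSpace m t) : ℝ :=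
  D.slopeCost x u (D.clip x r u)

lemma continuousOn_clip (ht : 0 ≤ t) (x : EuclideanSpace ℝ (Fin n)) (r : ℝ)
    (u : ControlSpace m t) : ContinuousOn (D.clip x r u) (Icc 0 t) :=
  ContinuousOn.inf ((D.continuousOn_traj ht x u).norm.pow 2) continuousOn_const

lemma clip_mem (x : EuclideanSpace ℝ (Fin n)) {r : ℝ} (hr : 0 ≤ r) (u : ControlSpace m t) (s : ℝ) :
    D.clip x r u s ∈ Icc 0 r :=
  ⟨le_min (sq_nonneg _) hr, min_le_right _ _⟩

lemma continuous_terminalCost : Continuous D.terminalCost := by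
  have : Continuous (Matrix.toEuclideanLin D.P) := LinearMap.continuous_of_finiteDimensional _
  unfold terminalCost
  fun_prop

namespace IsAdmissible

variable {D}

lemma terminalCost_combination (h : D.IsAdmissible) {l : ℝ} (hl : l ∈ Icc (0 : ℝ) 1)
    (y y' : EuclideanSpace ℝ (Fin n)) : D.terminalCost ((1 - l) • y + l • y')
      ≤ (1 - l) * D.terminalCost y + l * D.terminalCost y' := by
  have hP := (Matrix.isPositive_toEuclideanLin_iff.2 h.P_posSemidef).inner_nonneg_right
    ((y - D.z) - (y' - D.z))
  have hy : (1 - l) • y + l • y' - D.z = (1 - l) • (y - D.z) + l • (y' - D.z) := by module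
  unfold terminalCost
  rw [hy]
  generalize y - D.z = a at *
  generalize y' - D.z = b at *
  simp only [map_sub, map_add, map_smul, inner_sub_left, inner_sub_right, inner_add_left,
    inner_add_right, real_inner_smul_left, real_inner_smul_right] at hP ⊢
  nlinarith [mul_nonneg (mul_nonneg hl.1 (sub_nonneg.2 hl.2)) hP]

lemma continuousOn_slopeRunningCost (h : D.IsAdmissible) (ht : 0 ≤ t)
    (x : EuclideanSpace ℝ (Fin n)) (u : ControlSpace m t) {q : ℝ → ℝ}
    (hq : ContinuousOn q (Icc 0 t)) (hqm : MapsTo q (Icc 0 t) (Ico 0 (D.b ^ 2))) :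
    ContinuousOn (D.slopeRunningCost x u q) (Icc 0 t) := by
  have hρ := (D.continuousOn_traj ht x u).norm.pow 2
  exact (continuousOn_const.mul hρ).add (continuousOn_const.mul
    ((h.contDiffOn.continuousOn.comp hq hqm).add
      ((h.continuousOn_dφ.comp hq hqm).mul (hρ.sub hq))))

lemma integrableOn_slopeRunningCost (h : D.IsAdmissible) (ht : 0 ≤ t)
    (x : EuclideanSpace ℝ (Fin n)) (u : ControlSpace m t) {q : ℝ → ℝ}
    (hq : ContinuousOn q (Icc 0 t)) (hqm : MapsTo q (Icc 0 t) (Ico 0 (D.b ^ 2))) :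
    IntegrableOn (D.slopeRunningCost x u q) (Icc 0 t) :=
  (h.continuousOn_slopeRunningCost ht x u hq hqm).integrableOn_Icc

lemma mapsTo_clip (h : D.IsAdmissible) (x : EuclideanSpace ℝ (Fin n)) {r : ℝ}
    (hr : r ∈ Ico 0 (D.b ^ 2)) (u : ControlSpace m t) :
    MapsTo (D.clip x r u) (Icc 0 t) (Ico 0 (D.b ^ 2)) :=
  fun s _ => h.Icc_subset hr (D.clip_mem x hr.1 u s)

lemma dualAtSlope_mem_advPolicies (h : D.IsAdmissible) {q : ℝ → ℝ}
    (hq : ContinuousOn q (Icc 0 t)) (hqm : MapsTo q (Icc 0 t) (Ico 0 (D.b ^ 2))) :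
    (fun s => D.dualAtSlope (q s)) ∈ D.advPolicies t :=
  ⟨(h.continuousOn_dualAtSlope.comp hq hqm).aemeasurable measurableSet_Icc,
    fun _ hs => h.neg_φ_zero_le_dualAtSlope (hqm hs)⟩

lemma gameCost_dualAtSlope (h : D.IsAdmissible) (ht : 0 ≤ t)
    (x : EuclideanSpace ℝ (Fin n)) (u : ControlSpace m t) {q : ℝ → ℝ}
    (hq : ContinuousOn q (Icc 0 t)) (hqm : MapsTo q (Icc 0 t) (Ico 0 (D.b ^ 2))) :
    D.gameCost t x u (fun s => D.dualAtSlope (q s)) = (D.slopeCost x u q : EReal) := by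
  rw [gameCost, slopeCost, EReal.coe_add, EReal.coe_add,
    ← extIntegral_coe (h.integrableOn_slopeRunningCost ht x u hq hqm)]
  congr 2
  exact extIntegral_congr fun s hs =>
    congrArg _ (h.gameRunningCost_dualAtSlope (hqm hs) _)

lemma gameCost_le_regulatorCost (h : D.IsAdmissible) (x : EuclideanSpace ℝ (Fin n))
    (u : ControlSpace m t) {α : ℝ → ℝ} (hα : α ∈ D.advPolicies t) :
    D.gameCost t x u α ≤ D.regulatorCost t x u := by
  unfold gameCost regulatorCost
  gcongr
  exact extIntegral_mono fun s hs => h.gameRunningCost_le (hα.2 s hs) _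

lemma slopeCost_le_truncCost (h : D.IsAdmissible) (ht : 0 ≤ t) (x : EuclideanSpace ℝ (Fin n))
    (u : ControlSpace m t) {r : ℝ} (hr : r ∈ Ico 0 (D.b ^ 2)) {q : ℝ → ℝ}
    (hq : ContinuousOn q (Icc 0 t)) (hqm : MapsTo q (Icc 0 t) (Icc 0 r)) :
    D.slopeCost x u q ≤ D.truncCost x r u := by
  unfold truncCost slopeCost
  refine add_le_add_left (add_le_add_left ?_ _) _
  refine setIntegral_mono_on
    (h.integrableOn_slopeRunningCost ht x u hq fun s hs => h.Icc_subset hr (hqm hs))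
    (h.integrableOn_slopeRunningCost ht x u (D.continuousOn_clip ht x r u) (h.mapsTo_clip x hr u))
    measurableSet_Icc fun s hs => ?_
  unfold slopeRunningCost
  have := h.tangent_le_tangent_min hr (hqm hs) (sq_nonneg ‖D.traj x u s‖)
  gcongr
  exact this

lemma truncCost_mono (h : D.IsAdmissible) (ht : 0 ≤ t) (x : EuclideanSpace ℝ (Fin n))
    (u : ControlSpace m t) {r r' : ℝ} (hr : r ∈ Ico 0 (D.b ^ 2)) (hr' : r' ∈ Ico 0 (D.b ^ 2))
    (hle : r ≤ r') : D.truncCost x r u ≤ D.truncCost x r' u :=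
  h.slopeCost_le_truncCost ht x u hr' (D.continuousOn_clip ht x r u) fun s _ =>
    Icc_subset_Icc_right hle (D.clip_mem x hr.1 u s)

lemma le_truncCost (h : D.IsAdmissible) (ht : 0 ≤ t) (x : EuclideanSpace ℝ (Fin n))
    (u : ControlSpace m t) {r : ℝ} (hr : r ∈ Ico 0 (D.b ^ 2)) :
    t * (1 / 2 * D.φ 0) ≤ D.truncCost x r u := by
  have h1 : ∫ _ in Icc 0 t, (1 / 2 * D.φ 0) ≤ ∫ s in Icc 0 t, D.slopeRunningCost x u
      (D.clip x r u) s :=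
    setIntegral_mono_on continuousOn_const.integrableOn_Icc (h.integrableOn_slopeRunningCost ht x u
      (D.continuousOn_clip ht x r u) (h.mapsTo_clip x hr u)) measurableSet_Icc
      fun s _ => h.half_φ_zero_le hr (sq_nonneg _)
  have h2 : 0 ≤ D.controlCost u := mul_nonneg (by linarith [h.κ_pos]) (sq_nonneg _)
  have h3 : 0 ≤ D.terminalCost (D.traj x u t) := mul_nonneg (by norm_num)
    ((Matrix.isPositive_toEuclideanLin_iff.2 h.P_posSemidef).inner_nonneg_right _)
  rw [setIntegral_const, smul_eq_mul, Real.volume_real_Icc_of_le ht, sub_zero] at h1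
  unfold truncCost slopeCost
  linarith

lemma slopeCost_combination (h : D.IsAdmissible) (ht : 0 ≤ t) (x : EuclideanSpace ℝ (Fin n))
    (u v : ControlSpace m t) {q : ℝ → ℝ} (hq : ContinuousOn q (Icc 0 t))
    (hqm : MapsTo q (Icc 0 t) (Ico 0 (D.b ^ 2))) {l : ℝ} (hl : l ∈ Icc (0 : ℝ) 1) :
    D.slopeCost x ((1 - l) • u + l • v) q ≤ (1 - l) * D.slopeCost x u q + l * D.slopeCost x v q
      - D.κ / 2 * (l * (1 - l) * ‖u - v‖ ^ 2) := by
  have hint := fun w => h.integrableOn_slopeRunningCost ht x w hq hqm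
  have h1 : ∫ s in Icc 0 t, D.slopeRunningCost x ((1 - l) • u + l • v) q s
      ≤ (1 - l) * (∫ s in Icc 0 t, D.slopeRunningCost x u q s)
        + l * ∫ s in Icc 0 t, D.slopeRunningCost x v q s := by
    rw [← integral_const_mul, ← integral_const_mul,
      ← integral_add ((hint u).const_mul _) ((hint v).const_mul _)]
    refine setIntegral_mono_on (hint _) (((hint u).const_mul _).add ((hint v).const_mul _))
      measurableSet_Icc fun s hs => ?_
    unfold slopeRunningCost tangent
    rw [D.traj_combination x u v l hs, norm_sq_combination]
    have hK := h.K_add_dφ_nonneg (hqm hs)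
    have := mul_nonneg hK (mul_nonneg (mul_nonneg hl.1 (sub_nonneg.2 hl.2))
      (sq_nonneg ‖D.traj x u s - D.traj x v s‖))
    linarith
  have h2 := h.terminalCost_combination hl (D.traj x u t) (D.traj x v t)
  rw [← D.traj_combination x u v l ⟨ht, le_rfl⟩] at h2
  have h3 : D.controlCost ((1 - l) • u + l • v) = (1 - l) * D.controlCost u
      + l * D.controlCost v - D.κ / 2 * (l * (1 - l) * ‖u - v‖ ^ 2) := by
    unfold controlCost
    rw [norm_sq_combination]
    ring
  unfold slopeCost
  linarith

lemma truncCost_combination (h : D.IsAdmissible) (ht : 0 ≤ t) (x : EuclideanSpace ℝ (Fin n))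
    (u v : ControlSpace m t) {r : ℝ} (hr : r ∈ Ico 0 (D.b ^ 2)) {l : ℝ}
    (hl : l ∈ Icc (0 : ℝ) 1) :
    D.truncCost x r ((1 - l) • u + l • v) ≤ (1 - l) * D.truncCost x r u
      + l * D.slopeCost x v (D.clip x r ((1 - l) • u + l • v))
      - D.κ / 2 * (l * (1 - l) * ‖u - v‖ ^ 2) := by
  set w := (1 - l) • u + l • v
  have h1 := h.slopeCost_combination ht x u v (D.continuousOn_clip ht x r w)
    (h.mapsTo_clip x hr w) hl
  have h2 := h.slopeCost_le_truncCost ht x u hr (D.continuousOn_clip ht x r w)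
    fun s _ => D.clip_mem x hr.1 w s
  have h3 := mul_le_mul_of_nonneg_left h2 (sub_nonneg.2 hl.2)
  have h4 : D.truncCost x r w = D.slopeCost x w (D.clip x r w) := rfl
  linarith

lemma tendsto_slopeCost (h : D.IsAdmissible) (ht : 0 ≤ t) (x : EuclideanSpace ℝ (Fin n))
    {u : ℕ → ControlSpace m t} {v : ControlSpace m t} (hu : Tendsto u atTop (𝓝 v)) {r : ℝ}
    (hr : r ∈ Ico 0 (D.b ^ 2)) {q : ℕ → ℝ → ℝ} {p : ℝ → ℝ}
    (hq : ∀ k, ContinuousOn (q k) (Icc 0 t)) (hqm : ∀ k, MapsTo (q k) (Icc 0 t) (Icc 0 r))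
    (hlim : ∀ s ∈ Icc (0 : ℝ) t, Tendsto (fun k => q k s) atTop (𝓝 (p s))) :
    Tendsto (fun k => D.slopeCost x (u k) (q k)) atTop (𝓝 (D.slopeCost x v p)) := by
  have hsub := h.Icc_subset hr
  have hterm : Tendsto (fun k => D.terminalCost (D.traj x (u k) t)) atTop
      (𝓝 (D.terminalCost (D.traj x v t))) :=
    (D.continuous_terminalCost.tendsto _).comp (D.tendsto_traj x hu ⟨ht, le_rfl⟩)
  have hctrl : Tendsto (fun k => D.controlCost (u k)) atTop (𝓝 (D.controlCost v)) :=
    (hu.norm.pow 2).const_mul _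
  refine (Tendsto.add ?_ hctrl).add hterm
  obtain ⟨R, hR⟩ := D.exists_traj_bound ht x hu
  obtain ⟨C₁, hC₁⟩ := isCompact_Icc.exists_bound_of_continuousOn
    (h.contDiffOn.continuousOn.mono hsub)
  obtain ⟨C₂, hC₂⟩ := isCompact_Icc.exists_bound_of_continuousOn (h.continuousOn_dφ.mono hsub)
  refine tendsto_integral_of_dominated_convergence
    (fun _ => |D.K / 2| * R ^ 2 + 1 / 2 * (C₁ + C₂ * (R ^ 2 + r)))
    (fun k => (h.integrableOn_slopeRunningCost ht x (u k) (hq k)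
      fun s hs => hsub (hqm k hs)).aestronglyMeasurable) (integrable_const _) (fun k => ?_) ?_
    <;> filter_upwards [ae_restrict_mem measurableSet_Icc] with s hs
  · have hρ : ‖D.traj x (u k) s‖ ^ 2 ≤ R ^ 2 := pow_le_pow_left₀ (norm_nonneg _) (hR k s hs) 2
    have hρ0 := sq_nonneg ‖D.traj x (u k) s‖
    have hqs := hqm k hs
    have h1 := hC₁ _ hqs
    have h2 := hC₂ _ hqs
    simp only [Real.norm_eq_abs] at h1 h2
    have h3 : |‖D.traj x (u k) s‖ ^ 2 - q k s| ≤ R ^ 2 + r :=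
      abs_le.2 ⟨by linarith [hqs.2], by linarith [hqs.1, hr.1]⟩
    unfold slopeRunningCost tangent
    rw [Real.norm_eq_abs]
    refine (abs_add_le _ _).trans (add_le_add ?_ ?_)
    · rw [abs_mul, abs_of_nonneg hρ0]
      exact mul_le_mul_of_nonneg_left hρ (abs_nonneg _)
    · rw [abs_mul, abs_of_pos (by norm_num : (0 : ℝ) < 1 / 2)]
      refine mul_le_mul_of_nonneg_left ((abs_add_le _ _).trans (add_le_add h1 ?_)) (by norm_num)
      rw [abs_mul]
      exact mul_le_mul h2 h3 (abs_nonneg _) ((abs_nonneg _).trans h2)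
  · have hρ := ((D.tendsto_traj x hu hs).norm.pow 2)
    have hp : p s ∈ Ico 0 (D.b ^ 2) := hsub (isClosed_Icc.mem_of_tendsto (hlim s hs)
      (Eventually.of_forall fun k => hqm k hs))
    have hw : Tendsto (fun k => q k s) atTop (𝓝[Ico 0 (D.b ^ 2)] (p s)) :=
      tendsto_nhdsWithin_iff.2 ⟨hlim s hs, Eventually.of_forall fun k => hsub (hqm k hs)⟩
    exact (hρ.const_mul _).add (Tendsto.const_mul _
      ((Tendsto.comp (h.contDiffOn.continuousOn _ hp) hw).add
        ((Tendsto.comp (h.continuousOn_dφ _ hp) hw).mul (hρ.sub (hlim s hs)))))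

lemma tendsto_clip (_ : D.IsAdmissible) (x : EuclideanSpace ℝ (Fin n)) (r : ℝ)
    {u : ℕ → ControlSpace m t} {v : ControlSpace m t} (hu : Tendsto u atTop (𝓝 v)) {s : ℝ}
    (hs : s ∈ Icc 0 t) :
    Tendsto (fun k => D.clip x r (u k) s) atTop (𝓝 (D.clip x r v s)) :=
  ((D.tendsto_traj x hu hs).norm.pow 2).min tendsto_const_nhds

lemma tendsto_truncCost (h : D.IsAdmissible) (ht : 0 ≤ t) (x : EuclideanSpace ℝ (Fin n))
    {u : ℕ → ControlSpace m t} {v : ControlSpace m t} (hu : Tendsto u atTop (𝓝 v)) {r : ℝ}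
    (hr : r ∈ Ico 0 (D.b ^ 2)) :
    Tendsto (fun k => D.truncCost x r (u k)) atTop (𝓝 (D.truncCost x r v)) :=
  h.tendsto_slopeCost ht x hu hr (fun k => D.continuousOn_clip ht x r (u k))
    (fun k s _ => D.clip_mem x hr.1 (u k) s) fun _ hs => h.tendsto_clip x r hu hs

/-- The truncated costs converge to the regulator cost as the truncation level tends to `b²`. -/
lemma tendsto_truncCost_regulatorCost (h : D.IsAdmissible) (ht : 0 ≤ t)
    (x : EuclideanSpace ℝ (Fin n)) (u : ControlSpace m t) {r : ℕ → ℝ} (hmono : Monotone r)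
    (hr : ∀ k, r k ∈ Ico 0 (D.b ^ 2)) (hlim : Tendsto r atTop (𝓝 (D.b ^ 2))) :
    Tendsto (fun k => (D.truncCost x (r k) u : EReal)) atTop (𝓝 (D.regulatorCost t x u)) := by
  have key := tendsto_extIntegral (t := t)
    (f := fun k => D.slopeRunningCost x u (D.clip x (r k) u))
    (fun k => h.integrableOn_slopeRunningCost ht x u (D.continuousOn_clip ht x (r k) u)
      (h.mapsTo_clip x (hr k) u))
    (fun s _ i j hij => by
      have := h.truncated_mono (hr i) (hr j) (hmono hij) (sq_nonneg ‖D.traj x u s‖)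
      unfold slopeRunningCost clip
      linarith)
    (fun s _ => h.tendsto_truncated hr hlim (sq_nonneg ‖D.traj x u s‖))
  refine (EReal.tendsto_add_coe (EReal.tendsto_add_coe key _) _).congr fun k => ?_
  rw [truncCost, slopeCost, EReal.coe_add, EReal.coe_add]

end IsAdmissible

end RegulatorData

lemma cauchySeq_of_mul_norm_sub_sq_le {E : Type*} [SeminormedAddCommGroup E] {u : ℕ → E} {c : ℝ}
    (hc : 0 < c) {ε : ℕ → ℝ} (hε : Tendsto ε atTop (𝓝 0))
    (hu : ∀ k j, k ≤ j → c * ‖u j - u k‖ ^ 2 ≤ ε k) : CauchySeq u := by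
  refine Metric.cauchySeq_iff'.2 fun δ hδ => ?_
  obtain ⟨k, hk⟩ := (hε.eventually (gt_mem_nhds (by positivity : 0 < c * δ ^ 2))).exists
  refine ⟨k, fun j hj => ?_⟩
  rw [dist_eq_norm]
  exact lt_of_pow_lt_pow_left₀ 2 hδ.le
    (lt_of_mul_lt_mul_left ((hu k j hj).trans_lt hk) hc.le)

namespace RegulatorData.IsAdmissible

variable {n m : ℕ} {D : RegulatorData n m} {t : ℝ}

lemma norm_sub_sq_le_of_le_truncCost (h : D.IsAdmissible) (ht : 0 ≤ t)
    (x : EuclideanSpace ℝ (Fin n)) {r : ℝ} (hr : r ∈ Ico 0 (D.b ^ 2)) {M : ℝ}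
    (hM : ∀ w : ControlSpace m t, M ≤ D.truncCost x r w) (u v : ControlSpace m t) :
    D.κ / 4 * ‖u - v‖ ^ 2 ≤ (D.truncCost x r u - M) + (D.truncCost x r v - M) := by
  have h1 := h.truncCost_combination ht x u v hr (l := 1 / 2) ⟨by norm_num, by norm_num⟩
  set w := (1 - 1 / 2 : ℝ) • u + (1 / 2 : ℝ) • v
  have h2 := h.slopeCost_le_truncCost ht x v hr (D.continuousOn_clip ht x r w)
    fun s _ => D.clip_mem x hr.1 w s
  linarith [hM w]

lemma exists_minimizer_truncCost (h : D.IsAdmissible) (ht : 0 ≤ t)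
    (x : EuclideanSpace ℝ (Fin n)) {r : ℝ} (hr : r ∈ Ico 0 (D.b ^ 2)) :
    ∃ u : ControlSpace m t, ∀ v : ControlSpace m t, D.truncCost x r u ≤ D.truncCost x r v := by
  have hbdd : BddBelow (range fun u : ControlSpace m t => D.truncCost x r u) :=
    ⟨_, forall_mem_range.2 fun u => h.le_truncCost ht x u hr⟩
  set M := ⨅ u : ControlSpace m t, D.truncCost x r u with hM
  have hMle : ∀ w : ControlSpace m t, M ≤ D.truncCost x r w := fun w => ciInf_le hbdd w
  have hex : ∀ k : ℕ, ∃ u : ControlSpace m t, D.truncCost x r u < M + 1 / ((k : ℝ) + 1) :=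
    fun k => exists_lt_of_ciInf_lt (lt_add_of_pos_right _ Nat.one_div_pos_of_nat)
  choose u hu using hex
  have hε := tendsto_one_div_add_atTop_nhds_zero_nat (𝕜 := ℝ)
  have hC : CauchySeq u := by
    refine cauchySeq_of_mul_norm_sub_sq_le (c := D.κ / 4) (by linarith [h.κ_pos])
      (ε := fun k => 2 * (1 / ((k : ℝ) + 1))) (by simpa using hε.const_mul 2) fun k j hkj => ?_
    have h1 := h.norm_sub_sq_le_of_le_truncCost ht x hr hMle (u j) (u k)
    have h2 := Nat.one_div_le_one_div (α := ℝ) hkj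
    linarith [hu j, hu k]
  obtain ⟨v, hv⟩ := cauchySeq_tendsto_of_complete hC
  refine ⟨v, fun w => le_trans ?_ (hMle w)⟩
  refine le_of_tendsto_of_tendsto (h.tendsto_truncCost ht x hv hr) ?_
    (Eventually.of_forall fun k => (hu k).le)
  simpa using hε.const_add M

/-- Saddle point property: a minimizer of the truncated cost is optimal against the slopes that
are optimal against it. -/
lemma truncCost_le_slopeCost (h : D.IsAdmissible) (ht : 0 ≤ t)
    (x : EuclideanSpace ℝ (Fin n)) {r : ℝ} (hr : r ∈ Ico 0 (D.b ^ 2)) {u : ControlSpace m t}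
    (hu : ∀ v : ControlSpace m t, D.truncCost x r u ≤ D.truncCost x r v) (v : ControlSpace m t) :
    D.truncCost x r u ≤ D.slopeCost x v (D.clip x r u) := by
  set l : ℕ → ℝ := fun k => 1 / ((k : ℝ) + 1)
  have hl : Tendsto l atTop (𝓝 0) := tendsto_one_div_add_atTop_nhds_zero_nat
  set w : ℕ → ControlSpace m t := fun k => (1 - l k) • u + l k • v
  have hw : Tendsto w atTop (𝓝 u) := by
    have := ((hl.const_sub 1).smul_const u).add (hl.smul_const v)
    simpa using this
  refine ge_of_tendsto (h.tendsto_slopeCost ht x (tendsto_const_nhds (x := v)) hr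
    (fun k => D.continuousOn_clip ht x r (w k)) (fun k s _ => D.clip_mem x hr.1 (w k) s)
    fun s hs => h.tendsto_clip x r hw hs) (Eventually.of_forall fun k => ?_)
  have hl0 : 0 < l k := Nat.one_div_pos_of_nat
  have hl1 : l k ≤ 1 := by
    simpa [l] using Nat.one_div_le_one_div (α := ℝ) (Nat.zero_le k)
  have h1 := h.truncCost_combination ht x u v hr ⟨hl0.le, hl1⟩
  have h2 : 0 ≤ D.κ / 2 * (l k * (1 - l k) * ‖u - v‖ ^ 2) :=
    mul_nonneg (by linarith [h.κ_pos])
      (mul_nonneg (mul_nonneg hl0.le (sub_nonneg.2 hl1)) (sq_nonneg _))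
  have h3 : D.truncCost x r u ≤ D.truncCost x r (w k) := hu (w k)
  refine le_of_mul_le_mul_left ?_ hl0
  linarith

lemma exists_truncation_seq (h : D.IsAdmissible) : ∃ r : ℕ → ℝ, Monotone r ∧
    (∀ k, r k ∈ Ico 0 (D.b ^ 2)) ∧ Tendsto r atTop (𝓝 (D.b ^ 2)) := by
  obtain ⟨r, hmono, hr, hlim⟩ := exists_seq_strictMono_tendsto' (pow_pos h.b_pos 2)
  exact ⟨r, hmono.monotone, fun k => Ioo_subset_Ico_self (hr k), hlim⟩

lemma iSup_gameCost (h : D.IsAdmissible) (ht : 0 ≤ t) (x : EuclideanSpace ℝ (Fin n))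
    (u : ControlSpace m t) :
    ⨆ α ∈ D.advPolicies t, D.gameCost t x u α = D.regulatorCost t x u := by
  refine le_antisymm (iSup₂_le fun α hα => h.gameCost_le_regulatorCost x u hα) ?_
  obtain ⟨r, hmono, hr, hlim⟩ := h.exists_truncation_seq
  refine le_of_tendsto (h.tendsto_truncCost_regulatorCost ht x u hmono hr hlim)
    (Eventually.of_forall fun k => ?_)
  have hq := D.continuousOn_clip ht x (r k) u
  have hqm := h.mapsTo_clip x (hr k) u
  rw [truncCost, ← h.gameCost_dualAtSlope ht x u hq hqm]
  exact le_iSup₂_of_le _ (h.dualAtSlope_mem_advPolicies hq hqm) le_rfl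

lemma coe_truncCost_le_lowerValue (h : D.IsAdmissible) (ht : 0 ≤ t)
    (x : EuclideanSpace ℝ (Fin n)) {r : ℝ} (hr : r ∈ Ico 0 (D.b ^ 2)) {u : ControlSpace m t}
    (hu : ∀ v : ControlSpace m t, D.truncCost x r u ≤ D.truncCost x r v) :
    (D.truncCost x r u : EReal) ≤ D.lowerValue t x := by
  have hq := D.continuousOn_clip ht x r u
  have hqm := h.mapsTo_clip x hr u
  refine le_iSup₂_of_le _ (h.dualAtSlope_mem_advPolicies hq hqm) (le_iInf fun v => ?_)
  rw [h.gameCost_dualAtSlope ht x v hq hqm, EReal.coe_le_coe_iff]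
  exact h.truncCost_le_slopeCost ht x hr hu v

lemma regulatorValue_le_lowerValue (h : D.IsAdmissible) (ht : 0 ≤ t)
    (x : EuclideanSpace ℝ (Fin n)) : D.regulatorValue t x ≤ D.lowerValue t x := by
  obtain ⟨r, hmono, hr, hlim⟩ := h.exists_truncation_seq
  choose u hu using fun k => h.exists_minimizer_truncCost ht x (hr k)
  have hlow : ∀ k, (D.truncCost x (r k) (u k) : EReal) ≤ D.lowerValue t x :=
    fun k => h.coe_truncCost_le_lowerValue ht x (hr k) (hu k)
  rcases eq_or_ne (D.lowerValue t x) ⊤ with htop | htop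
  · exact htop ▸ le_top
  have hbot : D.lowerValue t x ≠ ⊥ := ((EReal.bot_lt_coe _).trans_le (hlow 0)).ne'
  obtain ⟨L, hL⟩ : ∃ L : ℝ, (L : EReal) = D.lowerValue t x :=
    ⟨_, EReal.coe_toReal htop hbot⟩
  rw [← hL] at hlow ⊢
  simp only [EReal.coe_le_coe_iff] at hlow
  have hstep : ∀ k j, k ≤ j → D.truncCost x (r k) (u j) ≤ D.truncCost x (r j) (u j) :=
    fun k j hkj => h.truncCost_mono ht x (u j) (hr k) (hr j) (hmono hkj)
  have hM : Monotone fun k => D.truncCost x (r k) (u k) :=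
    fun k j hkj => (hu k (u j)).trans (hstep k j hkj)
  obtain ⟨M, hlimM⟩ : ∃ M, Tendsto (fun k => D.truncCost x (r k) (u k)) atTop (𝓝 M) :=
    ⟨_, tendsto_atTop_ciSup hM ⟨L, forall_mem_range.2 hlow⟩⟩
  have hC : CauchySeq u := by
    refine cauchySeq_of_mul_norm_sub_sq_le (c := D.κ / 4) (by linarith [h.κ_pos])
      (ε := fun k => M - D.truncCost x (r k) (u k)) (by simpa using hlimM.const_sub M)
      fun k j hkj => ?_
    have h1 := h.norm_sub_sq_le_of_le_truncCost ht x (hr k) (hu k) (u j) (u k)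
    linarith [hstep k j hkj, hM.ge_of_tendsto hlimM j]
  obtain ⟨v, hv⟩ := cauchySeq_tendsto_of_complete hC
  refine (iInf_le _ v).trans
    (le_of_tendsto (h.tendsto_truncCost_regulatorCost ht x v hmono hr hlim)
      (Eventually.of_forall fun k => EReal.coe_le_coe_iff.2 ?_))
  refine le_of_tendsto (h.tendsto_truncCost ht x hv (hr k)) ?_
  filter_upwards [eventually_ge_atTop k] with j hj
  exact (hstep k j hj).trans (hlow j)

end RegulatorData.IsAdmissible

lemma RegulatorData.lowerValue_le_upperValue {n m : ℕ} (D : RegulatorData n m) (t : ℝ)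
    (x : EuclideanSpace ℝ (Fin n)) : D.lowerValue t x ≤ D.upperValue t x :=
  iSup₂_le fun α hα => le_iInf fun u =>
    (iInf_le _ u).trans (le_iSup₂ (f := fun α _ => D.gameCost t x u α) α hα)

theorem mainTheorem9 {n m : ℕ} (D : RegulatorData n m)
    (hB : D.B ≠ 0) (hκ : 0 < D.κ) (hP : D.P.PosSemidef) (hb : 0 < D.b)
    (hφ : ContDiffOn ℝ 2 D.φ (Ico 0 (D.b ^ 2)))
    (hφ'' : ∀ ρ ∈ Ico 0 (D.b ^ 2), 0 < D.ddφ ρ)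
    (hlim : Tendsto D.φ (𝓝[<] (D.b ^ 2)) atTop)
    (hK : -D.K ≤ D.dφ 0)
    (t : ℝ) (ht : 0 < t) (x : EuclideanSpace ℝ (Fin n)) :
    D.upperValue t x = D.regulatorValue t x ∧ D.upperValue t x = D.lowerValue t x := by
  have h : D.IsAdmissible := ⟨hκ, hP, hb, hφ, hφ'', hlim, hK⟩
  have h1 : D.upperValue t x = D.regulatorValue t x :=
    iInf_congr fun u => h.iSup_gameCost ht.le x u
  exact ⟨h1, le_antisymm (h1.trans_le (h.regulatorValue_le_lowerValue ht.le x))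
    (D.lowerValue_le_upperValue t x)⟩
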